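/- **Conventions.** A shift space is a closed, $\sigma$-invariant subset $X\subseteq\mathcal A^{\mathbb Z}$, where $\mathcal A$ is a finite discrete alphabet and $(\sigma x)_n=x_{n+1}$; $\mathcal B(X)$ is the set of finite words appearing in points of $X$. $X$ is irreducible if for all $u,v\in\mathcal B(X)$ there is $w\in\mathcal B(X)$ with $uwv\in\mathcal B(X)$; it is a shift of finite type if it is the set of all sequences avoiding a finite set of forbidden words. A factor code is a continuous, shift-equivariant surjection between shift spaces; a sofic shift is the image of a shift of finite type under a factor code. A point $y\in Y$ is doubly transitive if every word of $\mathcal B(Y)$ appears in $y$ infinitely often to the left and to the right. A factor code $\pi:X\to Y$ from an irreducible shift of finite type onto an irreducible sofic shift is almost invertible if every doubly transitive $y\in Y$ has exactly one $\pi$-preimage. All measures are Borel probability measures. The Gibbs relation $\mathfrak T_X\subseteq X\times X$ consists of the pairs $(x,x')$ that differ in only finitely many coordinates. A holonomy is a Borel isomorphism $\psi:E\to F$ between Borel sets $E,F\subseteq X$ with $(x,\psi(x))\in\mathfrak T_X$ for all $x\in E$. A measure $\mu$ on $X$ is $\mathfrak T_X$-nonsingular if for every Borel $E\subseteq X$ with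 $\mu(E)=0$ the saturation $\{x'\in X:\exists x\in E,\ (x,x')\in\mathfrak T_X\}$ is $\mu$-null. A cocycle on $\mathfrak T_X$ is a Borel function $\phi:\mathfrak T_X\to\mathbb R$ with $\phi(x,y)+\phi(y,z)=\phi(x,z)$ whenever $(x,y),(y,z)\in\mathfrak T_X$. A measure $\mu$ on $X$ is Gibbs for the cocycle $\phi$ if it is $\mathfrak T_X$-nonsingular and, for every holonomy $\psi:E\to F$, $\frac{d(\mu\circ\psi)}{d\mu}(x)=\exp(\phi(x,\psi(x)))$ for $\mu$-a.e. $x\in E$. **Proposition (lifting Gibbs measures through almost invertible factor codes).** Let $X$ be an irreducible shift of finite type, let $Y$ be a sofic shift, and let $\pi:X\to Y$ be an almost invertible factor code. Let $\nu$ be a measure on $Y$ which is fully supported, $\sigma$-invariant, ergodic and $\mathfrak T_Y$-nonsingular. If $\nu$ is Gibbs for an additive cocycle $\phi$ on $\mathfrak T_Y$, then every $\sigma$-invariant measure $\mu$ on $X$ with $\pi_*\mu=\nu$ is $\mathfrak T_X$-nonsingular, and is a Gibbs measure for the cocycle $\phi\circ(\pi\times\pi)$ on $\mathfrak T_X$.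 -/

import Mathlib

open MeasureTheory Set
open SymbolicDynamics.FullShift (Subshift)

namespace SoficGibbs

/-! ### Shift spaces over `ℤ`

A shift space over a finite discrete alphabet `A` is a term `X : Subshift A ℤ`; its points form the
subtype `X.carrier`, with the subspace topology and the Borel σ-algebra induced from `ℤ → A`. -/

section Shift

variable {A : Type*} [TopologicalSpace A]

/-- The shift `σ : X → X`, `(σ x) n = x (n + 1)`. -/
def shiftMap (X : Subshift A ℤ) : X.carrier → X.carrier :=
  fun x => ⟨SymbolicDynamics.FullShift.shift (1 : ℤ) x.1, X.mapsTo 1 x.2⟩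

/-- The word `w` appears in `x` at position `i`, i.e. `x_{[i, i + |w| - 1]} = w`. -/
def OccursAt (w : List A) (x : ℤ → A) (i : ℤ) : Prop :=
  ∀ (k : ℕ) (hk : k < w.length), x (i + k) = w[k]

/-- The language `𝓑(X)`: all finite words that appear in points of `X`. -/
def language (X : Subshift A ℤ) : Set (List A) :=
  {w | ∃ x ∈ X.carrier, OccursAt w x 0}

/-- Irreducibility of a shift space. -/
def IsIrreducible (X : Subshift A ℤ) : Prop :=
  ∀ u ∈ language X, ∀ v ∈ language X, ∃ w ∈ language X, u ++ w ++ v ∈ language X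

/-- Shifts of finite type: `X` is defined by a finite set of forbidden words of a length `n`. -/
def IsSFT (X : Subshift A ℤ) : Prop :=
  ∃ n : ℕ, 1 ≤ n ∧ ∃ F : Set (Fin n → A), F.Finite ∧
    X.carrier = {x | ∀ m : ℤ, (fun k : Fin n => x (m + (k : ℤ))) ∉ F}

/-- Doubly transitive points: every word of the language appears infinitely often to the left
and to the right. -/
def IsDoublyTransitive (X : Subshift A ℤ) (x : X.carrier) : Prop :=
  ∀ w ∈ language X, ∀ N : ℤ, (∃ i ≥ N, OccursAt w x.1 i) ∧ (∃ i ≤ N, OccursAt w x.1 i)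

end Shift

section Factor

variable {A B : Type*} [TopologicalSpace A] [TopologicalSpace B]

/-- Factor codes: continuous, shift-equivariant, surjective maps `π : X → Y`. -/
structure IsFactorCode (X : Subshift A ℤ) (Y : Subshift B ℤ) (π : X.carrier → Y.carrier) :
    Prop where
  continuous : Continuous π
  equivariant : ∀ x, π (shiftMap X x) = shiftMap Y (π x)
  surjective : Function.Surjective π

/-- Sofic shifts: factors of shifts of finite type. Up to renaming symbols, a finite alphabet is
`Fin k` (with the discrete topology). -/
def IsSofic (Y : Subshift B ℤ) : Prop :=
  ∃ (k : ℕ) (Z : Subshift (Fin k) ℤ) (ρ : Z.carrier → Y.carrier), IsSFT Z ∧ IsFactorCode Z Y ρ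

/-- Almost invertible factor codes from an irreducible shift of finite type onto an irreducible
sofic shift: every doubly transitive point of `Y` has a unique preimage. -/
structure IsAlmostInvertible (X : Subshift A ℤ) (Y : Subshift B ℤ)
    (π : X.carrier → Y.carrier) : Prop where
  sft : IsSFT X
  irreducible_source : IsIrreducible X
  sofic : IsSofic Y
  irreducible_target : IsIrreducible Y
  factor : IsFactorCode X Y π
  unique_preimage : ∀ y, IsDoublyTransitive Y y → ∃! x, π x = y

end Factor

/-! ### The Gibbs relation, cocycles and Gibbs measures

A real function on the Gibbs relation `𝔗_X` is written as a function `X × X → ℝ`; only its values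
on `𝔗_X` enter below. -/

section Gibbs

variable {A : Type*} [TopologicalSpace A]

/-- The Gibbs (asymptotic, homoclinic) relation `𝔗_X ⊆ X × X`. -/
def gibbsRel (X : Subshift A ℤ) : Set (X.carrier × X.carrier) :=
  {p | ∃ N : ℕ, 1 ≤ N ∧ ∀ i : ℤ, i ∉ Icc (-(N : ℤ)) (N : ℤ) → p.1.1 i = p.2.1 i}

/-- The saturation `𝔗_X(E)`. -/
def saturation (X : Subshift A ℤ) (E : Set X.carrier) : Set X.carrier :=
  {x' | ∃ x ∈ E, (x, x') ∈ gibbsRel X}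

variable [MeasurableSpace A]

/-- `𝔗_X`-nonsingular measures. -/
def IsNonsingular (X : Subshift A ℤ) (μ : Measure X.carrier) : Prop :=
  ∀ E : Set X.carrier, MeasurableSet E → μ E = 0 → μ (saturation X E) = 0

/-- A Borel isomorphism `ψ : E → F` is a holonomy of `𝔗_X` if it moves points inside
their `𝔗_X`-classes. -/
def IsHolonomy (X : Subshift A ℤ) {E F : Set X.carrier} (ψ : E ≃ᵐ F) : Prop :=
  ∀ x : E, ((x : X.carrier), (ψ x : X.carrier)) ∈ gibbsRel X

/-- Real additive cocycles on `𝔗_X`. -/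
structure IsCocycle (X : Subshift A ℤ) (φ : X.carrier × X.carrier → ℝ) : Prop where
  measurable : Measurable ((gibbsRel X).domRestrict φ)
  add : ∀ x y z, (x, y) ∈ gibbsRel X → (y, z) ∈ gibbsRel X → φ (x, y) + φ (y, z) = φ (x, z)

/-- `D : 𝔗_X → (0, ∞)` is a Radon-Nikodym cocycle of `μ`: for every holonomy `ψ : E → F` between
Borel sets, the measure `μ ∘ ψ : S ↦ μ (ψ(S))` on `E` has density `x ↦ D (x, ψ x)` with respect to
the restriction of `μ` to `E`. -/
structure IsRNCocycle (X : Subshift A ℤ) (μ : Measure X.carrier)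
    (D : X.carrier × X.carrier → ℝ) : Prop where
  measurable : Measurable ((gibbsRel X).domRestrict D)
  pos : ∀ p ∈ gibbsRel X, 0 < D p
  density : ∀ (E F : Set X.carrier), MeasurableSet E → MeasurableSet F →
    ∀ ψ : E ≃ᵐ F, IsHolonomy X ψ →
      μ.comap (fun x : E => (ψ x : X.carrier)) =
        (μ.comap (fun x : E => (x : X.carrier))).withDensity
          (fun x => ENNReal.ofReal (D ((x : X.carrier), (ψ x : X.carrier))))

/-- `μ` is a Gibbs measure for the cocycle `φ`: it is `𝔗_X`-nonsingular, and along every holonomy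
its Radon-Nikodym cocycle is almost everywhere `exp φ`. -/
structure IsGibbs (X : Subshift A ℤ) (μ : Measure X.carrier)
    (φ : X.carrier × X.carrier → ℝ) : Prop where
  cocycle : IsCocycle X φ
  nonsingular : IsNonsingular X μ
  rn : ∃ D : X.carrier × X.carrier → ℝ, IsRNCocycle X μ D ∧
    ∀ (E F : Set X.carrier), MeasurableSet E → MeasurableSet F →
      ∀ ψ : E ≃ᵐ F, IsHolonomy X ψ →
        ∀ᵐ x : E ∂(μ.comap (fun x : E => (x : X.carrier))),
          D ((x : X.carrier), (ψ x : X.carrier)) =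
            Real.exp (φ ((x : X.carrier), (ψ x : X.carrier)))

end Gibbs

end SoficGibbs

open Filter

namespace SoficGibbs

/-! ### Compactness, Borel structure and the shift as an automorphism. -/

section Topology

variable {A : Type*} [TopologicalSpace A]

/-! Full support and ergodicity make ν-almost every point doubly transitive
(`ae_isDoublyTransitive`). Over the doubly transitive points π is injective, so π identifies μ with
ν up to null sets, as Borel measures (`IsAlmostInvertible.comap_comp`). Being a sliding block code,
π sends asymptotic pairs to asymptotic pairs (`IsFactorCode.map_mem_gibbsRel`), and double
transitivity is constant on asymptotic classes. A holonomy of X, restricted to the points over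
doubly transitive ones, thus descends to a holonomy of Y, whose density under ν is exp φ; reading it
upstairs gives the density exp(φ ∘ (π × π)) under μ. Nonsingularity descends to Y in the same way.
-/

instance compactSpace_carrier [Finite A] (X : Subshift A ℤ) : CompactSpace X.carrier :=
  isCompact_iff_compactSpace.mp X.isClosed.isCompact

instance standardBorelSpace_carrier [Finite A] [DiscreteTopology A] [MeasurableSpace A]
    [BorelSpace A] (X : Subshift A ℤ) : StandardBorelSpace X.carrier :=
  X.isClosed.measurableSet.standardBorel

/-- The action of `ℤ` on a shift space by powers of the shift map. -/
def shiftBy (X : Subshift A ℤ) (g : ℤ) : X.carrier → X.carrier :=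
  fun x => ⟨SymbolicDynamics.FullShift.shift g x.1, X.mapsTo g x.2⟩

lemma shiftMap_coe (X : Subshift A ℤ) (x : X.carrier) (i : ℤ) :
    (shiftMap X x).1 i = x.1 (i + 1) := by
  simp [shiftMap, SymbolicDynamics.FullShift.shift, add_comm]

lemma shiftBy_coe (X : Subshift A ℤ) (g : ℤ) (x : X.carrier) (i : ℤ) :
    (shiftBy X g x).1 i = x.1 (i + g) := by
  simp [shiftBy, SymbolicDynamics.FullShift.shift, add_comm]

lemma continuous_shiftBy (X : Subshift A ℤ) (g : ℤ) : Continuous (shiftBy X g) :=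
  Continuous.subtype_mk
    ((SymbolicDynamics.FullShift.continuous_shift g).comp continuous_subtype_val) _

/-- The shift map as a measurable automorphism. -/
def shiftEquiv [Finite A] [DiscreteTopology A] [MeasurableSpace A] [BorelSpace A]
    (X : Subshift A ℤ) : X.carrier ≃ᵐ X.carrier where
  toFun := shiftMap X
  invFun := shiftBy X (-1)
  left_inv x := by ext i; simp [shiftMap_coe, shiftBy_coe]
  right_inv x := by ext i; simp [shiftMap_coe, shiftBy_coe]
  measurable_toFun := (continuous_shiftBy X 1).measurable
  measurable_invFun := (continuous_shiftBy X (-1)).measurable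

lemma shiftMap_injective (X : Subshift A ℤ) : Function.Injective (shiftMap X) := by
  intro x y h
  ext i
  have := congrArg (fun z : X.carrier => z.1 (i - 1)) h
  simpa [shiftMap_coe] using this

lemma iterate_shiftMap_coe (X : Subshift A ℤ) (n : ℕ) (x : X.carrier) (i : ℤ) :
    ((shiftMap X)^[n] x).1 i = x.1 (i + n) := by
  induction n generalizing i with
  | zero => simp
  | succ n ih =>
    rw [Function.iterate_succ_apply', shiftMap_coe, ih]
    push_cast; ring_nf

lemma iterate_shiftBy_neg_one_coe (X : Subshift A ℤ) (n : ℕ) (x : X.carrier) (i : ℤ) :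
    ((shiftBy X (-1))^[n] x).1 i = x.1 (i - n) := by
  induction n generalizing i with
  | zero => simp
  | succ n ih =>
    rw [Function.iterate_succ_apply', shiftBy_coe, ih]
    push_cast; ring_nf

lemma isClopen_setOf_occursAt [DiscreteTopology A] (X : Subshift A ℤ) (w : List A) (i : ℤ) :
    IsClopen {x : X.carrier | OccursAt w x.1 i} := by
  have h : {x : X.carrier | OccursAt w x.1 i} =
      ⋂ k : Fin w.length, (fun x : X.carrier => x.1 (i + (k : ℕ))) ⁻¹' {w[k]} := by
    ext x
    simp only [OccursAt, mem_ofPred_eq, mem_iInter, mem_preimage, mem_singleton_iff]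
    exact ⟨fun h k => h k k.2, fun h k hk => h ⟨k, hk⟩⟩
  rw [h]
  exact isClopen_iInter_of_finite fun k =>
    (isClopen_discrete _).preimage ((continuous_apply _).comp continuous_subtype_val)

end Topology

/-! ### Double transitivity: invariance, measurability, full measure. -/

section DoublyTransitive

variable {A : Type*} [TopologicalSpace A]

lemma isDoublyTransitive_of_mem_gibbsRel {X : Subshift A ℤ} {x x' : X.carrier}
    (h : (x, x') ∈ gibbsRel X) (hx : IsDoublyTransitive X x) : IsDoublyTransitive X x' := by
  obtain ⟨M, -, hM⟩ := h
  intro w hw N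
  constructor
  · obtain ⟨i, hi, ho⟩ := (hx w hw (max N (M + 1))).1
    refine ⟨i, le_trans (le_max_left _ _) hi, fun k hk => ?_⟩
    rw [← ho k hk]
    have : (M : ℤ) + 1 ≤ i := le_trans (le_max_right _ _) hi
    exact (hM _ (by simp only [mem_Icc, not_and_or]; right; lia)).symm
  -- Subtracting the length of `w` keeps the whole occurrence to the left of the window `[-M, M]`.
  · obtain ⟨i, hi, ho⟩ := (hx w hw (min N (-M - 1 - w.length))).2
    refine ⟨i, le_trans hi (min_le_left _ _), fun k hk => ?_⟩
    rw [← ho k hk]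
    have : i ≤ -(M : ℤ) - 1 - w.length := le_trans hi (min_le_right _ _)
    exact (hM _ (by simp only [mem_Icc, not_and_or]; left; lia)).symm

lemma gibbsRel_symm {X : Subshift A ℤ} {x x' : X.carrier} (h : (x, x') ∈ gibbsRel X) :
    (x', x) ∈ gibbsRel X := by
  obtain ⟨N, h1, h2⟩ := h
  exact ⟨N, h1, fun i hi => (h2 i hi).symm⟩

lemma isDoublyTransitive_iff_of_mem_gibbsRel {X : Subshift A ℤ} {x x' : X.carrier}
    (h : (x, x') ∈ gibbsRel X) : IsDoublyTransitive X x ↔ IsDoublyTransitive X x' :=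
  ⟨isDoublyTransitive_of_mem_gibbsRel h, isDoublyTransitive_of_mem_gibbsRel (gibbsRel_symm h)⟩

variable [Finite A] [DiscreteTopology A] [MeasurableSpace A] [BorelSpace A]

lemma measurableSet_isDoublyTransitive (X : Subshift A ℤ) :
    MeasurableSet {x : X.carrier | IsDoublyTransitive X x} := by
  have hm : ∀ (w : List A) (i : ℤ), MeasurableSet {x : X.carrier | OccursAt w x.1 i} :=
    fun w i => (isClopen_setOf_occursAt X w i).isOpen.measurableSet
  have h : {x : X.carrier | IsDoublyTransitive X x} = ⋂ w ∈ language X, ⋂ N : ℤ,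
      (⋃ i ≥ N, {x : X.carrier | OccursAt w x.1 i}) ∩
        (⋃ i ≤ N, {x : X.carrier | OccursAt w x.1 i}) := by
    ext x
    simp [IsDoublyTransitive]
  rw [h]
  exact MeasurableSet.biInter (to_countable _) fun w _ => MeasurableSet.iInter fun N =>
    (MeasurableSet.biUnion (to_countable _) fun i _ => hm w i).inter
      (MeasurableSet.biUnion (to_countable _) fun i _ => hm w i)

/-- Almost every orbit of an ergodic measure preserving automorphism visits a given set of
positive measure infinitely often. -/
lemma ae_frequently_iterate_mem_of_ergodic {α : Type*} [MeasurableSpace α] {μ : Measure α}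
    [IsProbabilityMeasure μ] {T : α → α} (hT : Ergodic T μ) {s : Set α} (hs : MeasurableSet s)
    (h0 : μ s ≠ 0) : ∀ᵐ x ∂μ, ∃ᶠ n in atTop, T^[n] x ∈ s := by
  have hc : Conservative T μ := hT.toMeasurePreserving.conservative
  have hmeas : MeasurableSet {x | ∃ᶠ n in atTop, T^[n] x ∈ s} := by
    have h : {x | ∃ᶠ n in atTop, T^[n] x ∈ s} = ⋂ N : ℕ, ⋃ n ≥ N, T^[n] ⁻¹' s := by
      ext x; simp [frequently_atTop]
    rw [h]
    exact MeasurableSet.iInter fun N => MeasurableSet.biUnion (to_countable _) fun n _ =>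
      (hT.measurable.iterate n) hs
  have hinv : T ⁻¹' {x | ∃ᶠ n in atTop, T^[n] x ∈ s} = {x | ∃ᶠ n in atTop, T^[n] x ∈ s} := by
    ext x
    simp only [mem_preimage, mem_ofPred_eq, ← Function.iterate_succ_apply]
    rw [frequently_atTop, frequently_atTop]
    refine ⟨fun h N => ?_, fun h N => ?_⟩
    · obtain ⟨n, hn, hx⟩ := h N
      exact ⟨n + 1, by lia, hx⟩
    · obtain ⟨n, hn, hx⟩ := h (N + 1)
      obtain ⟨m, rfl⟩ : ∃ m, n = m + 1 := ⟨n - 1, by lia⟩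
      exact ⟨m, by lia, hx⟩
  rcases hT.ae_mem_or_ae_notMem hmeas hinv with h | h
  · exact h
  -- Poincaré recurrence inside the positive-measure set `s` excludes the null case of the zero-one
  -- law.
  · obtain ⟨x, ⟨-, hx⟩, hx'⟩ :=
      ((hc.frequently_ae_mem_and_frequently_image_mem hs.nullMeasurableSet h0).and_eventually
        h).exists
    exact absurd hx hx'

/-- There are countably many words, and full support gives each cylinder positive measure.
Recurrence under the shift yields occurrences to the right, under its inverse (also ergodic) those
to the left. -/
lemma ae_isDoublyTransitive {X : Subshift A ℤ} {ν : Measure X.carrier} [IsProbabilityMeasure ν]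
    (hsupp : ν.IsOpenPosMeasure) (herg : Ergodic (shiftMap X) ν) :
    ∀ᵐ x ∂ν, IsDoublyTransitive X x := by
  have herg' : Ergodic (shiftBy X (-1)) ν := Ergodic.symm (e := shiftEquiv X) herg
  have key : ∀ w ∈ language X, ∀ᵐ x : X.carrier ∂ν, ∀ N : ℤ,
      (∃ i ≥ N, OccursAt w x.1 i) ∧ (∃ i ≤ N, OccursAt w x.1 i) := by
    rintro w ⟨x₀, hx₀, hw⟩
    have ho := (isClopen_setOf_occursAt X w 0).isOpen
    have hpos : ν {x : X.carrier | OccursAt w x.1 0} ≠ 0 :=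
      ho.measure_ne_zero ν ⟨⟨x₀, hx₀⟩, hw⟩
    filter_upwards [ae_frequently_iterate_mem_of_ergodic herg ho.measurableSet hpos,
      ae_frequently_iterate_mem_of_ergodic herg' ho.measurableSet hpos] with x h1 h2 N
    constructor
    · obtain ⟨n, hn, h⟩ := frequently_atTop.1 h1 N.toNat
      refine ⟨n, by lia, fun k hk => ?_⟩
      rw [← h k hk, iterate_shiftMap_coe]
      ring_nf
    · obtain ⟨n, hn, h⟩ := frequently_atTop.1 h2 (-N).toNat
      refine ⟨-n, by lia, fun k hk => ?_⟩
      rw [← h k hk, iterate_shiftBy_neg_one_coe]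
      ring_nf
  exact (ae_ball_iff (to_countable _)).2 key

end DoublyTransitive

/-! ### Factor codes as sliding block codes; fibres over doubly transitive points. -/

section SlidingBlock

variable {A B : Type*} [TopologicalSpace A] [TopologicalSpace B]

/-- A continuous map from a shift space to a finite discrete set depends on finitely many
coordinates. -/
lemma exists_window_of_continuous [Finite A] [DiscreteTopology A] [DiscreteTopology B]
    (X : Subshift A ℤ) {f : X.carrier → B} (hf : Continuous f) :
    ∃ N : ℕ, ∀ x x' : X.carrier, (∀ i ∈ Icc (-(N : ℤ)) N, x.1 i = x'.1 i) → f x = f x' := by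
  by_contra! hcon
  -- These nested compact sets would have a common point: a pair equal in every coordinate but with
  -- different images.
  let t : ℕ → Set (X.carrier × X.carrier) := fun N =>
    {p | (∀ i ∈ Icc (-(N : ℤ)) N, p.1.1 i = p.2.1 i) ∧ f p.1 ≠ f p.2}
  have hcl : ∀ N, IsClosed (t N) := by
    intro N
    refine IsClosed.inter (s₁ := {p : X.carrier × X.carrier |
      ∀ i ∈ Icc (-(N : ℤ)) N, p.1.1 i = p.2.1 i})
      (s₂ := {p : X.carrier × X.carrier | f p.1 ≠ f p.2}) ?_ ?_
    · have h : {p : X.carrier × X.carrier | ∀ i ∈ Icc (-(N : ℤ)) N, p.1.1 i = p.2.1 i} =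
          ⋂ i ∈ Icc (-(N : ℤ)) N, {p | p.1.1 i = p.2.1 i} := by ext p; simp
      rw [h]
      exact isClosed_biInter fun i _ => isClosed_eq
        ((continuous_apply i).comp (continuous_subtype_val.comp continuous_fst))
        ((continuous_apply i).comp (continuous_subtype_val.comp continuous_snd))
    · exact (isClopen_discrete {q : B × B | q.1 ≠ q.2}).isClosed.preimage
        ((hf.comp continuous_fst).prodMk (hf.comp continuous_snd))
  obtain ⟨p, hp⟩ := IsCompact.nonempty_iInter_of_sequence_nonempty_isCompact_isClosed t
    (fun N p hp => ⟨fun i hi => hp.1 i (by simp only [mem_Icc] at hi ⊢; lia), hp.2⟩)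
    (fun N => by
      obtain ⟨x, x', h1, h2⟩ := hcon N
      exact ⟨(x, x'), h1, h2⟩)
    (hcl 0).isCompact hcl
  rw [mem_iInter] at hp
  refine (hp 0).2 (congrArg f ?_)
  ext i
  exact (hp i.natAbs).1 i (by simp only [mem_Icc]; lia)

lemma shiftBy_add_one (X : Subshift A ℤ) (g : ℤ) (x : X.carrier) :
    shiftBy X (g + 1) x = shiftMap X (shiftBy X g x) := by
  ext i
  simp only [shiftMap_coe, shiftBy_coe]
  ring_nf

lemma map_shiftBy_of_equivariant {X : Subshift A ℤ} {Y : Subshift B ℤ}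
    {π : X.carrier → Y.carrier} (h : ∀ x, π (shiftMap X x) = shiftMap Y (π x)) (g : ℤ)
    (x : X.carrier) : π (shiftBy X g x) = shiftBy Y g (π x) := by
  induction g with
  | zero =>
    have h1 : shiftBy X 0 x = x := by ext i; simp [shiftBy_coe]
    have h2 : shiftBy Y 0 (π x) = π x := by ext i; simp [shiftBy_coe]
    rw [h1, h2]
  | succ n ih => rw [shiftBy_add_one, shiftBy_add_one, h, ih]
  | pred n ih =>
    apply shiftMap_injective
    rw [← h, ← shiftBy_add_one, ← shiftBy_add_one]
    simpa using ih

/-- A factor code maps asymptotic pairs to asymptotic pairs. -/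
lemma IsFactorCode.map_mem_gibbsRel [Finite A] [DiscreteTopology A] [DiscreteTopology B]
    {X : Subshift A ℤ} {Y : Subshift B ℤ} {π : X.carrier → Y.carrier} (hπ : IsFactorCode X Y π)
    {x x' : X.carrier} (h : (x, x') ∈ gibbsRel X) : (π x, π x') ∈ gibbsRel Y := by
  obtain ⟨N, hN⟩ := exists_window_of_continuous X
    ((continuous_apply (0 : ℤ)).comp (continuous_subtype_val.comp hπ.continuous))
  obtain ⟨M, hM1, hM⟩ := h
  -- Coordinate `i` of the image sees only `[i - N, i + N]`, which misses `[-M, M]` once `|i| > M +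
  -- N`.
  refine ⟨M + N, by lia, fun i hi => ?_⟩
  have key : ∀ z : X.carrier, (π z).1 i = (π (shiftBy X i z)).1 0 := fun z => by
    rw [map_shiftBy_of_equivariant hπ.equivariant, shiftBy_coe, zero_add]
  simp only [key]
  refine hN _ _ fun j hj => ?_
  rw [shiftBy_coe, shiftBy_coe]
  refine hM _ ?_
  simp only [mem_Icc] at hi hj ⊢
  push_cast at hi
  lia

lemma IsAlmostInvertible.injOn {X : Subshift A ℤ} {Y : Subshift B ℤ}
    {π : X.carrier → Y.carrier} (hπ : IsAlmostInvertible X Y π) :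
    InjOn π (π ⁻¹' {y | IsDoublyTransitive Y y}) :=
  fun x hx _ _ h => (hπ.unique_preimage (π x) hx).unique rfl h.symm

lemma IsAlmostInvertible.preimage_image_eq {X : Subshift A ℤ} {Y : Subshift B ℤ}
    {π : X.carrier → Y.carrier} (hπ : IsAlmostInvertible X Y π) {E : Set X.carrier}
    (hE : E ⊆ π ⁻¹' {y | IsDoublyTransitive Y y}) : π ⁻¹' (π '' E) = E := by
  refine Subset.antisymm ?_ (subset_preimage_image π E)
  rintro x ⟨x', hx', h⟩
  have hx : x ∈ π ⁻¹' {y | IsDoublyTransitive Y y} := by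
    have := hE hx'
    simp only [mem_preimage, h] at this ⊢
    exact this
  rwa [← hπ.injOn (hE hx') hx h]

end SlidingBlock

/-! ### Densities along pairs of measurable embeddings. -/

section Transport

lemma _root_.MeasurableEmbedding.map_withDensity_comp {α β : Type*} [MeasurableSpace α]
    [MeasurableSpace β] {f : α → β} (hf : MeasurableEmbedding f) (m : Measure α)
    (g : β → ENNReal) : (m.withDensity (g ∘ f)).map f = (m.map f).withDensity g := by
  ext s hs
  rw [hf.map_apply, withDensity_apply _ (hf.measurable hs), withDensity_apply _ hs,
    hf.restrict_map, hf.lintegral_map]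
  rfl

variable {A : Type*} [TopologicalSpace A] [MeasurableSpace A]

/-- The Gibbs property along a partial isomorphism presented by a pair of embeddings. -/
lemma IsGibbs.comap_eq_withDensity {Y : Subshift A ℤ} {ν : Measure Y.carrier}
    {φ : Y.carrier × Y.carrier → ℝ} (h : IsGibbs Y ν φ) {κ : Type*} [MeasurableSpace κ]
    {e₁ e₂ : κ → Y.carrier} (h₁ : MeasurableEmbedding e₁) (h₂ : MeasurableEmbedding e₂)
    (hrel : ∀ k, (e₁ k, e₂ k) ∈ gibbsRel Y) :
    ν.comap e₂ = (ν.comap e₁).withDensity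
      (fun k => ENNReal.ofReal (Real.exp (φ (e₁ k, e₂ k)))) := by
  obtain ⟨D, hD, hDφ⟩ := h.rn
  let r₁ := h₁.equivRange
  let r₂ := h₂.equivRange
  -- The holonomy `e₁ k ↦ e₂ k`; its density identity is then pulled back to `κ` through `r₁`.
  let ψ : range e₁ ≃ᵐ range e₂ := r₁.symm.trans r₂
  have hψ : ∀ k, ψ (r₁ k) = r₂ k := fun k => by simp [ψ]
  have hr₁ : ∀ k, (r₁ k : Y.carrier) = e₁ k := fun k => by simp [r₁]
  have hr₂ : ∀ k, (r₂ k : Y.carrier) = e₂ k := fun k => by simp [r₂]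
  have hhol : IsHolonomy Y ψ := by
    intro y
    obtain ⟨k, rfl⟩ := r₁.surjective y
    rw [hψ, hr₁, hr₂]
    exact hrel k
  have hd := hD.density _ _ h₁.measurableSet_range h₂.measurableSet_range ψ hhol
  have hae := hDφ _ _ h₁.measurableSet_range h₂.measurableSet_range ψ hhol
  rw [withDensity_congr_ae (hae.mono fun y hy => congrArg ENNReal.ofReal hy)] at hd
  have hcomap : ∀ {f : range e₁ → Y.carrier}, MeasurableEmbedding f →
      (ν.comap f).map r₁.symm = ν.comap (f ∘ r₁) := by
    intro f hf
    rw [MeasurableEquiv.map_symm, Measure.comap_comap]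
    · exact fun s hs => r₁.measurableEmbedding.measurableSet_image.2 hs
    · exact hf.injective
    · exact fun s hs => hf.measurableSet_image.2 hs
  have hval := MeasurableEmbedding.subtype_coe h₁.measurableSet_range
  have hval₂ := (MeasurableEmbedding.subtype_coe h₂.measurableSet_range).comp
    ψ.measurableEmbedding
  have hd' := congrArg (Measure.map r₁.symm) hd
  have hg : (fun y : range e₁ => ENNReal.ofReal (Real.exp (φ ((y : Y.carrier),
      (ψ y : Y.carrier))))) =
      (fun k => ENNReal.ofReal (Real.exp (φ (e₁ k, e₂ k)))) ∘ r₁.symm := by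
    ext y
    obtain ⟨k, rfl⟩ := r₁.surjective y
    simp [hψ, hr₁, hr₂]
  rw [hg, r₁.symm.measurableEmbedding.map_withDensity_comp] at hd'
  have e2 : (fun x : range e₁ => (ψ x : Y.carrier)) ∘ r₁ = e₂ := by
    ext1 k; simp [hψ, hr₂]
  have e1 : (fun x : range e₁ => (x : Y.carrier)) ∘ r₁ = e₁ := by
    ext1 k; simp [hr₁]
  have c2 := hcomap hval₂
  have c1 := hcomap hval
  change (ν.comap (fun x : range e₁ => (ψ x : Y.carrier))).map r₁.symm =
    ν.comap ((fun x : range e₁ => (ψ x : Y.carrier)) ∘ r₁) at c2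
  rw [e2] at c2
  rw [e1] at c1
  rwa [c2, c1] at hd'

/-- Equality of a measure with a density can be checked on a conull measurable set. -/
lemma eq_withDensity_of_comap_subtype {α : Type*} [MeasurableSpace α] {m₁ m₂ : Measure α}
    {s : Set α} (hs : MeasurableSet s) (h₁ : m₁ sᶜ = 0) (h₂ : m₂ sᶜ = 0) {g : α → ENNReal}
    (h : m₁.comap ((↑) : s → α) = (m₂.comap ((↑) : s → α)).withDensity (g ∘ (↑))) :
    m₁ = m₂.withDensity g := by
  have hr : ∀ m : Measure α, m sᶜ = 0 → (m.comap ((↑) : s → α)).map (↑) = m := by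
    intro m hm
    rw [map_comap_subtype_coe hs]
    exact Measure.restrict_eq_self_of_ae_mem (mem_ae_iff.2 hm)
  have h' := congrArg (Measure.map ((↑) : s → α)) h
  rwa [(MeasurableEmbedding.subtype_coe hs).map_withDensity_comp, hr _ h₁, hr _ h₂] at h'

end Transport

/-! ### Lifting nonsingularity and the Gibbs property. -/

section Lift

variable {A B : Type*}
  [Finite A] [TopologicalSpace A] [DiscreteTopology A] [MeasurableSpace A] [BorelSpace A]
  [Finite B] [TopologicalSpace B] [DiscreteTopology B] [MeasurableSpace B] [BorelSpace B]
  {X : Subshift A ℤ} {Y : Subshift B ℤ} {π : X.carrier → Y.carrier}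
  {ν : Measure Y.carrier} {μ : Measure X.carrier}

/-- Lusin–Souslin: injective Borel images in standard Borel spaces are Borel. -/
lemma IsAlmostInvertible.measurableSet_image (hπ : IsAlmostInvertible X Y π) {E : Set X.carrier}
    (hE : E ⊆ π ⁻¹' {y | IsDoublyTransitive Y y}) (hEm : MeasurableSet E) :
    MeasurableSet (π '' E) :=
  hEm.image_of_measurable_injOn hπ.factor.continuous.measurable (hπ.injOn.mono hE)

lemma IsAlmostInvertible.measure_image (hπ : IsAlmostInvertible X Y π) (hμ : μ.map π = ν)
    {E : Set X.carrier} (hE : E ⊆ π ⁻¹' {y | IsDoublyTransitive Y y}) (hEm : MeasurableSet E) :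
    ν (π '' E) = μ E := by
  rw [← hμ, Measure.map_apply hπ.factor.continuous.measurable (hπ.measurableSet_image hE hEm),
    hπ.preimage_image_eq hE]

/-- `Measure.comap` is zero by default for maps that are not injective with null-measurable images,
so pulling ν back along `π ∘ i` needs this. -/
lemma IsAlmostInvertible.measurableEmbedding_comp (hπ : IsAlmostInvertible X Y π) {κ : Type*}
    [MeasurableSpace κ] {i : κ → X.carrier} (hi : MeasurableEmbedding i)
    (hr : ∀ k, IsDoublyTransitive Y (π (i k))) : MeasurableEmbedding (π ∘ i) where
  injective := fun k k' h => hi.injective (hπ.injOn (hr k) (hr k') h)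
  measurable := hπ.factor.continuous.measurable.comp hi.measurable
  measurableSet_image' := fun s hs => by
    rw [image_comp]
    exact hπ.measurableSet_image (by rintro _ ⟨k, -, rfl⟩; exact hr k)
      (hi.measurableSet_image.2 hs)

lemma IsAlmostInvertible.comap_comp (hπ : IsAlmostInvertible X Y π) (hμ : μ.map π = ν)
    {κ : Type*} [MeasurableSpace κ] {i : κ → X.carrier} (hi : MeasurableEmbedding i)
    (hr : ∀ k, IsDoublyTransitive Y (π (i k))) : ν.comap (π ∘ i) = μ.comap i := by
  ext s hs
  rw [(hπ.measurableEmbedding_comp hi hr).comap_apply, hi.comap_apply, image_comp,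
    hπ.measure_image hμ (by rintro _ ⟨k, -, rfl⟩; exact hr k) (hi.measurableSet_image.2 hs)]

lemma measure_compl_preimage_isDoublyTransitive (hπ : Continuous π) (hμ : μ.map π = ν)
    (hν : ∀ᵐ y ∂ν, IsDoublyTransitive Y y) :
    μ (π ⁻¹' {y | IsDoublyTransitive Y y})ᶜ = 0 := by
  rw [← preimage_compl, ← Measure.map_apply hπ.measurable
    (measurableSet_isDoublyTransitive Y).compl, hμ]
  exact hν

/-- The saturation of `E` lies in the π-preimage of the saturation of `π '' (E ∩ X₀)`, up to points
not over doubly transitive ones. -/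
lemma IsAlmostInvertible.isNonsingular_lift (hπ : IsAlmostInvertible X Y π) (hμ : μ.map π = ν)
    (hν : ∀ᵐ y ∂ν, IsDoublyTransitive Y y) (hns : IsNonsingular Y ν) : IsNonsingular X μ := by
  intro E hE hE0
  set X₀ := π ⁻¹' {y | IsDoublyTransitive Y y} with hX₀
  have hX₀m : MeasurableSet X₀ :=
    hπ.factor.continuous.measurable (measurableSet_isDoublyTransitive Y)
  have h0 : ν (π '' (E ∩ X₀)) = 0 := by
    rw [hπ.measure_image hμ inter_subset_right (hE.inter hX₀m)]
    exact measure_mono_null inter_subset_left hE0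
  have h1 := hns _ (hπ.measurableSet_image inter_subset_right (hE.inter hX₀m)) h0
  have h2 : μ (π ⁻¹' saturation Y (π '' (E ∩ X₀))) = 0 := by
    subst hμ
    exact (Measure.QuasiMeasurePreserving.preimage_null
      ⟨hπ.factor.continuous.measurable, Measure.AbsolutelyContinuous.rfl⟩ h1)
  refine measure_mono_null ?_ (measure_union_null h2
    (measure_compl_preimage_isDoublyTransitive hπ.factor.continuous hμ hν))
  rintro x' ⟨x, hx, hrel⟩
  have hrel' := hπ.factor.map_mem_gibbsRel hrel
  by_cases hx0 : x ∈ X₀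
  · exact Or.inl ⟨π x, mem_image_of_mem π ⟨hx, hx0⟩, hrel'⟩
  · exact Or.inr fun h => hx0 ((isDoublyTransitive_iff_of_mem_gibbsRel hrel').2 h)

lemma IsCocycle.comp_prodMap {φ : Y.carrier × Y.carrier → ℝ} (hφ : IsCocycle Y φ)
    (hπ : IsFactorCode X Y π) : IsCocycle X (φ ∘ Prod.map π π) where
  measurable := by
    have hm : Measurable fun p : gibbsRel X =>
        (⟨Prod.map π π p.1, hπ.map_mem_gibbsRel p.2⟩ : gibbsRel Y) :=
      ((hπ.continuous.measurable.prodMap hπ.continuous.measurable).comp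
        measurable_subtype_coe).subtype_mk
    exact hφ.measurable.comp hm
  add x y z hxy hyz := hφ.add _ _ _ (hπ.map_mem_gibbsRel hxy) (hπ.map_mem_gibbsRel hyz)

lemma IsAlmostInvertible.density_lift (hπ : IsAlmostInvertible X Y π) (hμ : μ.map π = ν)
    (hν : ∀ᵐ y ∂ν, IsDoublyTransitive Y y) {φ : Y.carrier × Y.carrier → ℝ}
    (hgibbs : IsGibbs Y ν φ) {E F : Set X.carrier} (hE : MeasurableSet E) (hF : MeasurableSet F)
    (ψ : E ≃ᵐ F) (hψ : IsHolonomy X ψ) :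
    μ.comap (fun x : E => (ψ x : X.carrier)) =
      (μ.comap (fun x : E => (x : X.carrier))).withDensity
        (fun x => ENNReal.ofReal (Real.exp (φ (π x, π (ψ x))))) := by
  let s : Set E := {x | IsDoublyTransitive Y (π x)}
  have hs : MeasurableSet s := (hπ.factor.continuous.measurable.comp measurable_subtype_coe)
    (measurableSet_isDoublyTransitive Y)
  have hnull := measure_compl_preimage_isDoublyTransitive hπ.factor.continuous hμ hν
  have hrel : ∀ x : E, (π x, π (ψ x)) ∈ gibbsRel Y :=
    fun x => hπ.factor.map_mem_gibbsRel (hψ x)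
  have hi₁ : MeasurableEmbedding (fun x : E => (x : X.carrier)) :=
    MeasurableEmbedding.subtype_coe hE
  have hi₂ : MeasurableEmbedding (fun x : E => (ψ x : X.carrier)) :=
    (MeasurableEmbedding.subtype_coe hF).comp ψ.measurableEmbedding
  have hsc := MeasurableEmbedding.subtype_coe hs
  have hr₁ : ∀ x : s, IsDoublyTransitive Y (π ((x : E) : X.carrier)) := fun x => x.2
  have hr₂ : ∀ x : s, IsDoublyTransitive Y (π (ψ (x : E) : X.carrier)) :=
    fun x => (isDoublyTransitive_iff_of_mem_gibbsRel (hrel x)).1 x.2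
  have hcc : ∀ {f : E → X.carrier}, MeasurableEmbedding f →
      (μ.comap f).comap ((↑) : s → E) = μ.comap (f ∘ (↑)) := fun hf =>
    Measure.comap_comap (fun t ht => hsc.measurableSet_image.2 ht) hf.injective
      (fun t ht => hf.measurableSet_image.2 ht) μ
  refine eq_withDensity_of_comap_subtype hs ?_ ?_ ?_
  · rw [hi₂.comap_apply]
    refine measure_mono_null ?_ hnull
    rintro _ ⟨x, hx, rfl⟩ h
    exact hx ((isDoublyTransitive_iff_of_mem_gibbsRel (hrel x)).2 h)
  · rw [hi₁.comap_apply]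
    refine measure_mono_null ?_ hnull
    rintro _ ⟨x, hx, rfl⟩ h
    exact hx h
  -- On `s` both `x` and `ψ x` lie over doubly transitive points, so both pullbacks of μ are
  -- pullbacks of ν.
  · rw [hcc hi₁, hcc hi₂, ← hπ.comap_comp hμ (hi₁.comp hsc) hr₁,
      ← hπ.comap_comp hμ (hi₂.comp hsc) hr₂]
    exact hgibbs.comap_eq_withDensity (hπ.measurableEmbedding_comp (hi₁.comp hsc) hr₁)
      (hπ.measurableEmbedding_comp (hi₂.comp hsc) hr₂) fun x => hrel x

lemma IsAlmostInvertible.isGibbs_lift (hπ : IsAlmostInvertible X Y π) (hμ : μ.map π = ν)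
    (hν : ∀ᵐ y ∂ν, IsDoublyTransitive Y y) {φ : Y.carrier × Y.carrier → ℝ}
    (hgibbs : IsGibbs Y ν φ) : IsGibbs X μ (φ ∘ Prod.map π π) where
  cocycle := hgibbs.cocycle.comp_prodMap hπ.factor
  nonsingular := hπ.isNonsingular_lift hμ hν hgibbs.nonsingular
  rn := by
    -- With the exponential itself as Radon–Nikodym cocycle, the almost everywhere agreement holds
    -- by definition.
    refine ⟨fun p => Real.exp (φ (Prod.map π π p)), ⟨?_, fun p _ => Real.exp_pos _, ?_⟩,
      fun E F _ _ ψ _ => ae_of_all _ fun x => rfl⟩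
    · exact Real.measurable_exp.comp (hgibbs.cocycle.comp_prodMap hπ.factor).measurable
    · exact fun E F hE hF ψ hψ => hπ.density_lift hμ hν hgibbs hE hF ψ hψ

end Lift

end SoficGibbs

theorem mainTheorem4
    {A B : Type*}
    [Finite A] [TopologicalSpace A] [DiscreteTopology A] [MeasurableSpace A] [BorelSpace A]
    [Finite B] [TopologicalSpace B] [DiscreteTopology B] [MeasurableSpace B] [BorelSpace B]
    (X : Subshift A ℤ) (Y : Subshift B ℤ)
    (hX : SoficGibbs.IsSFT X) (hXirr : SoficGibbs.IsIrreducible X)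
    (hY : SoficGibbs.IsSofic Y)
    (π : X.carrier → Y.carrier) (hπ : SoficGibbs.IsAlmostInvertible X Y π)
    (ν : Measure Y.carrier) [IsProbabilityMeasure ν]
    (hν_supp : ν.IsOpenPosMeasure)
    (hν_inv : MeasurePreserving (SoficGibbs.shiftMap Y) ν ν)
    (hν_erg : Ergodic (SoficGibbs.shiftMap Y) ν)
    (hν_ns : SoficGibbs.IsNonsingular Y ν)
    (φ : Y.carrier × Y.carrier → ℝ) (hφ : SoficGibbs.IsCocycle Y φ)
    (hν_gibbs : SoficGibbs.IsGibbs Y ν φ)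
    (μ : Measure X.carrier) [IsProbabilityMeasure μ]
    (hμ_inv : MeasurePreserving (SoficGibbs.shiftMap X) μ μ)
    (hμ : μ.map π = ν) :
    SoficGibbs.IsNonsingular X μ ∧ SoficGibbs.IsGibbs X μ (φ ∘ Prod.map π π) := by
  have hdt := SoficGibbs.ae_isDoublyTransitive hν_supp hν_erg
  exact ⟨hπ.isNonsingular_lift hμ hdt hν_ns, hπ.isGibbs_lift hμ hdt hν_gibbs⟩
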